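/- Let $G$ be a finite simple graph with vertex set $V=V(G)$ and complement $\overline G$. For a finite index set of size $n$, let $\mathcal{DNN}^n$ be the set of real symmetric positive semidefinite matrices with nonnegative entries, and $\mathcal{CP}^n$ the set of Gram matrices of families of $n$ entrywise nonnegative vectors in some $\mathbb R^d$, $d\ge 1$. Let $J$ be the all-ones matrix. For a nonempty graph $H$ let $$\vartheta^+(H)=\min\{s\in\mathbb R : \exists Z\in\mathcal{DNN}^{|V(H)|},\ Z-J\succeq 0,\ Z_{uu}=s\ \forall u\in V(H),\ Z_{uv}=0\ \forall \{u,v\}\in E(\overline H)\}$$ (the minimum is attained). For an integer $t\ge 0$ put $[t]=\{1,\dots,t\}$, and for a symmetric matrix $X$ indexed by $(V\times[t])\cup\{0\}$ consider the conditions - (C1) $X_{0,0}=1$; - (C3a) $\sum_{i\in[t]}X_{0,ui}=1$ for all $u\in V$; - (C3b) $\sum_{i,j\in[t]}X_{ui,uj}=1$ for all $u\in V$; - (O3) $X_{ui,vi}=0$ for all $i\in[t]$ and $\{u,v\}\in E(G)$; - (O4) $X_{ui,uj}=0$ for all $i\neq j$ in $[t]$ and $u\in V$. For $\mathcal K\in\{\mathcal{DNN},\mathcal{CP}\}$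 and $t\ge 1$ consider the assertions - (i) there is $X\in\mathcal K^{|V|}$ with $\lceil X_{uu}\rceil=t$ for all $u\in V$, $X_{uv}=0$ for all $\{u,v\}\in E(G)$, and $X-J\succeq 0$; - (ii) there is $X\in\mathcal K^{|V|t+1}$ satisfying (C1), (C3a), (C3b), (O3), (O4); - (iii) there is $X\in\mathcal K^{|V|t+1}$ satisfying (C1), (C3a), (C3b), (O3). Then: 1. If $\mathcal K=\mathcal{DNN}$, then (i) $\Leftrightarrow$ (ii) $\Leftrightarrow$ (iii) for every integer $t\ge1$. 2. If $\mathcal K=\mathcal{CP}$, then (iii) $\Leftrightarrow$ (ii) $\Rightarrow$ (i) for every integer $t\ge1$. 3. If $\mathcal K=\mathcal{DNN}$ and $V\neq\emptyset$, the least integer $t\ge 0$ for which there is $X\in\mathcal{K}^{|V|t+1}$ satisfying (C1), (C3a), (C3b), (O3), (O4) is $\lceil\vartheta^+(\overline G)\rceil$, and the same holds without (O4). 4. If $\mathcal K=\mathcal{CP}$, the least integer $t\ge 0$ for which there is $X\in\mathcal K^{|V|t+1}$ satisfying (C1), (C3a), (C3b), (O3), (O4) is the chromatic number $\chi(G)$,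 and the same holds without (O4). -/

import Mathlib

/-- The cone of doubly nonnegative matrices with rows and columns indexed by `ι`:
positive semidefinite real (symmetric) matrices with nonnegative entries. -/
def DNNCone (ι : Type*) [Fintype ι] : Set (Matrix ι ι ℝ) :=
  {X | X.PosSemidef ∧ ∀ i j, 0 ≤ X i j}

/-- The cone of completely positive matrices with rows and columns indexed by `ι`:
Gram matrices of families of entrywise nonnegative vectors of some `ℝ ^ d`, `d ≥ 1`. -/
def CPCone (ι : Type*) [Fintype ι] : Set (Matrix ι ι ℝ) :=
  {X | ∃ d : ℕ, 1 ≤ d ∧ ∃ x : ι → Fin d → ℝ,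
    (∀ i k, 0 ≤ x i k) ∧ ∀ i j, X i j = x i ⬝ᵥ x j}

/-- The all-ones matrix `J`. -/
def onesMatrix (ι : Type*) : Matrix ι ι ℝ := Matrix.of fun _ _ => 1

/-- The index set `(V × [t]) ∪ {0}`; the extra index `0` is `none`, and `ui` is `some (u, i)`. -/
abbrev ColorIndex (V : Type*) (t : ℕ) : Type _ := Option (V × Fin t)

/-- The linear constraints on a matrix indexed by `(V × [t]) ∪ {0}`, without the orthogonality
conditions between different colors at the same vertex. -/
structure WeakColorConstraints {V : Type*} (G : SimpleGraph V) (t : ℕ)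
    (X : Matrix (ColorIndex V t) (ColorIndex V t) ℝ) : Prop where
  corner : X none none = 1
  sum_row : ∀ u : V, ∑ i : Fin t, X none (some (u, i)) = 1
  sum_block : ∀ u : V, ∑ i : Fin t, ∑ j : Fin t, X (some (u, i)) (some (u, j)) = 1
  orth_edge : ∀ i : Fin t, ∀ u v : V, G.Adj u v → X (some (u, i)) (some (v, i)) = 0

/-- All linear constraints of the conic feasibility program for the quantum chromatic number. -/
structure ColorConstraints {V : Type*} (G : SimpleGraph V) (t : ℕ)
    (X : Matrix (ColorIndex V t) (ColorIndex V t) ℝ) : Prop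
    extends WeakColorConstraints G t X where
  orth_color : ∀ i j : Fin t, i ≠ j → ∀ u : V, X (some (u, i)) (some (u, j)) = 0

/-- The constraints on a matrix indexed by the vertices: `⌈X u u⌉ = t` for every vertex `u`, `X u v = 0` on edges,
and `X - J` is positive semidefinite. -/
structure ThetaConstraints {V : Type*} [Fintype V] (G : SimpleGraph V) (t : ℕ)
    (X : Matrix V V ℝ) : Prop where
  ceil_diag : ∀ u : V, ⌈X u u⌉ = (t : ℤ)
  edge : ∀ u v : V, G.Adj u v → X u v = 0
  sub_ones : (X - onesMatrix V).PosSemidef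

/-- The real numbers `s` that are feasible for the minimization program defining `ϑ⁺(H)`. -/
def thetaPlusFeasible {V : Type*} [Fintype V] (H : SimpleGraph V) : Set ℝ :=
  {s | ∃ Z ∈ DNNCone V, (Z - onesMatrix V).PosSemidef ∧ (∀ u : V, Z u u = s) ∧
    ∀ u v : V, Hᶜ.Adj u v → Z u v = 0}

/-- The parameter `ϑ⁺(H)`: the optimal value of its minimization program. -/
noncomputable def thetaPlus {V : Type*} [Fintype V] (H : SimpleGraph V) : ℝ :=
  sInf (thetaPlusFeasible H)

/-! For each cone, feasibility is reduced to one parameter.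

CP: a coordinate where the Gram vector of index `0` is nonzero selects a colour at every vertex, so
weak feasibility forces a `t`-colouring; conversely, a colouring gives a rank-one 0/1 solution.

DNN: for `t ≥ 1`, everything is equivalent to `t ∈ thetaPlusFeasible Gᶜ`. Both directions rest on `t
I - J ⪰ 0`: summing the equal-colour blocks of `X` and scaling by `t` gives `Z`, while `Z` is lifted
to a rank-one matrix plus a multiple of `(Z - J) ⊗ (t I - J)`. Raising diagonals makes the feasible
set upward closed, whence the ceiling. -/

open Matrix Finset

/-! ### Positive semidefinite matrices and Gram representations -/

section PosSemidef

variable {ι : Type*}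

theorem Matrix.PosSemidef.symm_apply {X : Matrix ι ι ℝ} (h : X.PosSemidef) (i j : ι) :
    X i j = X j i := by
  simpa using (h.1.apply i j).symm

variable [Fintype ι]

theorem sum_mul_mul_eq_dotProduct_mulVec (X : Matrix ι ι ℝ) (a : ι → ℝ) :
    ∑ i, ∑ j, a i * X i j * a j = star a ⬝ᵥ X *ᵥ a := by
  simp [dotProduct, mulVec, mul_sum, mul_assoc]

theorem posSemidef_of_sum_nonneg {X : Matrix ι ι ℝ} (hs : ∀ i j, X i j = X j i)
    (h : ∀ a : ι → ℝ, 0 ≤ ∑ i, ∑ j, a i * X i j * a j) : X.PosSemidef := by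
  refine posSemidef_iff_dotProduct_mulVec.2 ⟨?_, fun a => ?_⟩
  · ext i j
    simp [hs i j]
  · rw [← sum_mul_mul_eq_dotProduct_mulVec]
    exact h a

theorem Matrix.PosSemidef.sum_nonneg {X : Matrix ι ι ℝ} (h : X.PosSemidef) (a : ι → ℝ) :
    0 ≤ ∑ i, ∑ j, a i * X i j * a j := by
  rw [sum_mul_mul_eq_dotProduct_mulVec]
  exact h.dotProduct_mulVec_nonneg a

theorem posSemidef_of_gram {κ : Type*} [Fintype κ] {X : Matrix ι ι ℝ} (x : ι → κ → ℝ)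
    (h : ∀ i j, X i j = x i ⬝ᵥ x j) : X.PosSemidef := by
  have : X = (of x) * (of x)ᴴ := by
    ext i j
    simp [h, mul_apply, dotProduct]
  rw [this]
  exact posSemidef_self_mul_conjTranspose _

theorem Matrix.PosSemidef.exists_gram {X : Matrix ι ι ℝ} (h : X.PosSemidef) :
    ∃ x : ι → ι → ℝ, ∀ i j, X i j = x i ⬝ᵥ x j := by
  classical
  open scoped MatrixOrder in
  obtain ⟨b, hb⟩ := CStarAlgebra.nonneg_iff_eq_star_mul_self.mp h.nonneg
  refine ⟨fun i k => b k i, fun i j => ?_⟩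
  simp [hb, star_eq_conjTranspose, mul_apply, dotProduct]

/-- Expand the squared norms of `x i ± x j` for Gram vectors. With a constant diagonal this bounds
every entry by the diagonal value. -/
theorem Matrix.PosSemidef.two_mul_abs_le {X : Matrix ι ι ℝ} (h : X.PosSemidef) (i j : ι) :
    2 * |X i j| ≤ X i i + X j j := by
  obtain ⟨x, hx⟩ := h.exists_gram
  have h1 : 0 ≤ ∑ k, (x i k - x j k) ^ 2 := Finset.sum_nonneg fun _ _ => sq_nonneg _
  have h2 : 0 ≤ ∑ k, (x i k + x j k) ^ 2 := Finset.sum_nonneg fun _ _ => sq_nonneg _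
  have e1 : ∑ k, (x i k - x j k) ^ 2 = X i i + X j j - 2 * X i j := by
    simp only [hx, dotProduct, mul_sum, ← sum_add_distrib, ← sum_sub_distrib]
    exact sum_congr rfl fun _ _ => by ring
  have e2 : ∑ k, (x i k + x j k) ^ 2 = X i i + X j j + 2 * X i j := by
    simp only [hx, dotProduct, mul_sum, ← sum_add_distrib]
    exact sum_congr rfl fun _ _ => by ring
  rcases abs_cases (X i j) with ⟨h, _⟩ | ⟨h, _⟩ <;> rw [h] <;> linarith

/-- Extending a positive semidefinite matrix by a zero row and column. -/
theorem Matrix.PosSemidef.option_extend {X : Matrix ι ι ℝ} (h : X.PosSemidef) :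
    (of fun p q : Option ι => p.elim 0 fun i => q.elim 0 fun j => X i j).PosSemidef := by
  obtain ⟨x, hx⟩ := h.exists_gram
  refine posSemidef_of_gram (fun p => p.elim 0 x) fun p q => ?_
  cases p <;> cases q <;> simp [hx]

/-- `t I - J` is positive semidefinite in size `t`. -/
theorem posSemidef_smul_one_sub_ones (t : ℕ) :
    ((t : ℝ) • (1 : Matrix (Fin t) (Fin t) ℝ) - onesMatrix (Fin t)).PosSemidef := by
  refine posSemidef_of_sum_nonneg (fun i j => ?_) fun a => ?_
  · simp [onesMatrix, one_apply, eq_comm]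
  · have := sq_sum_le_card_mul_sum_sq (s := (univ : Finset (Fin t))) (f := a)
    rw [card_univ, Fintype.card_fin] at this
    have e : ∑ i, ∑ j, a i * ((t : ℝ) • (1 : Matrix (Fin t) (Fin t) ℝ) - onesMatrix (Fin t)) i j
        * a j = t * ∑ i, a i ^ 2 - (∑ i, a i) ^ 2 := by
      rw [sq, sum_mul_sum, mul_sum, ← sum_sub_distrib]
      refine sum_congr rfl fun i _ => ?_
      simp [onesMatrix, one_apply, mul_sub, sub_mul, sum_sub_distrib]
      ring
    rw [e]
    linarith

theorem isClosed_setOf_posSemidef : IsClosed {X : Matrix ι ι ℝ | X.PosSemidef} := by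
  have : {X : Matrix ι ι ℝ | X.PosSemidef} =
      {X | ∀ i j, X i j = X j i} ∩ {X | ∀ a : ι → ℝ, 0 ≤ ∑ i, ∑ j, a i * X i j * a j} := by
    ext X
    exact ⟨fun h => ⟨h.symm_apply, h.sum_nonneg⟩, fun h => posSemidef_of_sum_nonneg h.1 h.2⟩
  rw [this]
  refine IsClosed.inter ?_ ?_
  · simp only [Set.ofPred_forall]
    exact isClosed_iInter fun i => isClosed_iInter fun j =>
      isClosed_eq (by fun_prop) (by fun_prop)
  · simp only [Set.ofPred_forall]
    exact isClosed_iInter fun a => isClosed_le (by fun_prop) (by fun_prop)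

theorem cpCone_subset_dnnCone : CPCone ι ⊆ DNNCone ι := by
  rintro X ⟨d, -, x, hx, h⟩
  refine ⟨posSemidef_of_gram x h, fun i j => ?_⟩
  rw [h]
  exact Finset.sum_nonneg fun k _ => mul_nonneg (hx i k) (hx j k)

end PosSemidef

/-! ### Completely positive solutions and colourings -/

section Coloring

variable {V : Type*} {G : SimpleGraph V} {t : ℕ}

/-- In a Gram representation, the colour vectors at each vertex sum to the vector of index `0`. -/
theorem WeakColorConstraints.sum_gram {κ : Type*} [Fintype κ]
    {X : Matrix (ColorIndex V t) (ColorIndex V t) ℝ} (hX : WeakColorConstraints G t X)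
    (x : ColorIndex V t → κ → ℝ) (h : ∀ p q, X p q = x p ⬝ᵥ x q) (u : V) :
    ∑ i, x (some (u, i)) = x none := by
  have h1 : x none ⬝ᵥ x none = 1 := by rw [← h, hX.corner]
  have h2 : x none ⬝ᵥ ∑ i, x (some (u, i)) = 1 := by
    rw [dotProduct_sum, ← hX.sum_row u]
    simp [h]
  have h3 : (∑ i, x (some (u, i))) ⬝ᵥ ∑ i, x (some (u, i)) = 1 := by
    rw [sum_dotProduct, ← hX.sum_block u]
    simp [h, dotProduct_sum]
  -- Two unit vectors with inner product one differ by a vector of norm zero.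
  rw [← sub_eq_zero, ← dotProduct_self_eq_zero]
  rw [sub_dotProduct, dotProduct_sub, dotProduct_sub, h1, h2, h3, dotProduct_comm, h2]
  norm_num

variable [Fintype V]

/-- Orthogonal nonnegative vectors have disjoint supports, so at a fixed coordinate `k` adjacent
vertices cannot both be nonzero in the same colour. -/
theorem colorable_of_mem_cpCone {X : Matrix (ColorIndex V t) (ColorIndex V t) ℝ}
    (hX : X ∈ CPCone (ColorIndex V t)) (hc : WeakColorConstraints G t X) : G.Colorable t := by
  obtain ⟨d, -, x, hx, h⟩ := hX
  have hne : x none ≠ 0 := fun h0 => by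
    have := hc.corner
    rw [h, h0] at this
    simp at this
  obtain ⟨k, hk⟩ := Function.ne_iff.1 hne
  have hex : ∀ u, ∃ i, x (some (u, i)) k ≠ 0 := fun u => by
    by_contra! hu
    apply hk
    rw [← hc.sum_gram x h u]
    simp [hu]
  choose c hcol using hex
  refine ⟨SimpleGraph.Coloring.mk c fun {u v} huv heq => ?_⟩
  have h0 := hc.orth_edge (c u) u v huv
  rw [h, dotProduct, sum_eq_zero_iff_of_nonneg fun k _ => mul_nonneg (hx _ k) (hx _ k)] at h0
  rcases mul_eq_zero.1 (h0 k (mem_univ k)) with h1 | h1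
  · exact hcol u h1
  · exact hcol v (heq ▸ h1)

theorem exists_colorConstraints_of_colorable (h : G.Colorable t) :
    ∃ X ∈ CPCone (ColorIndex V t), ColorConstraints G t X := by
  classical
  obtain ⟨c⟩ := h
  let x : ColorIndex V t → ℝ := fun p => p.elim 1 fun q => if c q.1 = q.2 then 1 else 0
  refine ⟨of fun p q => x p * x q, ⟨1, le_rfl, fun p _ => x p, ?_, ?_⟩, ⟨⟨?_, ?_, ?_, ?_⟩, ?_⟩⟩
  · rintro (_ | q) -
    · simp [x]
    · simp only [x, Option.elim]
      split_ifs <;> simp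
  · simp [dotProduct]
  · simp [x]
  · simp [x]
  · simp [x]
  · intro i u v huv
    have := c.valid huv
    simp only [of_apply, x, Option.elim]
    split_ifs with h1 h2 <;> simp_all
  · intro i j hij u
    simp only [of_apply, x, Option.elim]
    split_ifs with h1 h2 <;> simp_all

theorem exists_thetaConstraints_of_colorable (h : G.Colorable t) :
    ∃ X ∈ CPCone V, ThetaConstraints G t X := by
  classical
  -- The Gram vectors below live in `ℝ ^ t`, and `CPCone` demands positive dimension.
  rcases Nat.eq_zero_or_pos t with rfl | ht
  · have : IsEmpty V := by
      obtain ⟨c⟩ := h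
      exact ⟨fun v => (c v).elim0⟩
    exact ⟨0, ⟨1, le_rfl, 0, by simp, by simp⟩, by simp, by simp,
      posSemidef_of_sum_nonneg (by simp) (by simp)⟩
  obtain ⟨c⟩ := h
  refine ⟨of fun u v => if c u = c v then (t : ℝ) else 0,
    ⟨t, ht, fun u i => if c u = i then √t else 0, fun u i => ?_, fun u v => ?_⟩, ⟨?_, ?_, ?_⟩⟩
  · dsimp only
    split_ifs <;> positivity
  · simp [dotProduct, eq_comm]
  · simp
  · intro u v huv
    simpa using fun h => absurd h (c.valid huv)
  · convert (posSemidef_smul_one_sub_ones t).submatrix c using 1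
    ext u v
    simp [onesMatrix, one_apply]

end Coloring

/-! ### Doubly nonnegative solutions and `ϑ⁺` -/

section Theta

variable {V : Type*} [Fintype V] {G : SimpleGraph V} {t : ℕ}

/-- Raising the diagonal entries to a common upper bound preserves feasibility. -/
theorem mem_thetaPlusFeasible_of_diag_le {X : Matrix V V ℝ} {s : ℝ} (hX : X ∈ DNNCone V)
    (hJ : (X - onesMatrix V).PosSemidef) (he : ∀ u v, G.Adj u v → X u v = 0)
    (hd : ∀ u, X u u ≤ s) : s ∈ thetaPlusFeasible Gᶜ := by
  classical
  have hD : (diagonal fun u => s - X u u).PosSemidef :=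
    PosSemidef.diagonal fun u => sub_nonneg.2 (hd u)
  refine ⟨X + diagonal fun u => s - X u u, ⟨hX.1.add hD, fun i j => ?_⟩, ?_, fun u => by simp,
    fun u v huv => ?_⟩
  · refine add_nonneg (hX.2 i j) ?_
    rw [diagonal_apply]
    split_ifs
    · exact sub_nonneg.2 (hd i)
    · exact le_rfl
  · rw [add_sub_right_comm]
    exact hJ.add hD
  · rw [compl_compl] at huv
    simp [he u v huv, diagonal_apply_ne _ huv.ne]

theorem mem_thetaPlusFeasible_of_thetaConstraints {X : Matrix V V ℝ} (hX : X ∈ DNNCone V)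
    (h : ThetaConstraints G t X) : (t : ℝ) ∈ thetaPlusFeasible Gᶜ := by
  refine mem_thetaPlusFeasible_of_diag_le hX h.sub_ones h.edge fun u => ?_
  have := Int.le_ceil (X u u)
  rwa [h.ceil_diag u, Int.cast_natCast] at this

theorem exists_thetaConstraints_of_mem {s : ℝ} (hs : s ∈ thetaPlusFeasible Gᶜ)
    (ht : ⌈s⌉ = (t : ℤ)) : ∃ X ∈ DNNCone V, ThetaConstraints G t X := by
  obtain ⟨Z, hZ, hJ, hd, he⟩ := hs
  rw [compl_compl] at he
  exact ⟨Z, hZ, fun u => by rw [hd, ht], he, hJ⟩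

theorem exists_colorConstraints_of_mem_thetaPlusFeasible (ht : 1 ≤ t)
    (hs : (t : ℝ) ∈ thetaPlusFeasible Gᶜ) :
    ∃ X ∈ DNNCone (ColorIndex V t), ColorConstraints G t X := by
  classical
  obtain ⟨Z, hZ, hJ, hd, he⟩ := hs
  rw [compl_compl] at he
  -- At `t = 1` the constant `c` below degenerates; but then `Z - J` has zero diagonal, so an edge,
  -- with entry `-1`, is impossible.
  rcases ht.eq_or_lt with rfl | ht
  · suffices h : G.Colorable 1 by
      obtain ⟨X, hX, hc⟩ := exists_colorConstraints_of_colorable h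
      exact ⟨X, cpCone_subset_dnnCone hX, hc⟩
    refine ⟨SimpleGraph.Coloring.mk (fun _ => 0) fun {u v} huv => ?_⟩
    have := hJ.two_mul_abs_le u v
    simp [onesMatrix, hd, he u v huv] at this
    norm_num at this
  have ht1 : (1 : ℝ) < t := by exact_mod_cast ht
  have ht0 : (t : ℝ) ≠ 0 := by positivity
  have ht2 : (t : ℝ) - 1 ≠ 0 := by linarith
  -- Entries for distinct colours are `1 / t ^ 2 - c * (Z u v - 1)`; this `c` makes them vanish when
  -- `Z u v = t`, in particular at `u = v`. It also turns equal-colour entries into `Z u v / t ^ 2`,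
  -- which vanish on edges.
  let c : ℝ := ((t : ℝ) ^ 2 * (t - 1))⁻¹
  have hc : 0 ≤ c := inv_nonneg.2 (mul_nonneg (sq_nonneg _) (by linarith))
  let e : ColorIndex V t → ℝ := fun p => p.elim 1 fun _ => (t : ℝ)⁻¹
  let K : Matrix (V × Fin t) (V × Fin t) ℝ :=
    of fun p q => c * ((Z p.1 q.1 - 1) * ((if p.2 = q.2 then (t : ℝ) else 0) - 1))
  have hK : K.PosSemidef := by
    have : K = c • kroneckerMap (· * ·) (Z - onesMatrix V)
        ((t : ℝ) • (1 : Matrix (Fin t) (Fin t) ℝ) - onesMatrix (Fin t)) := by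
      ext p q
      simp [K, onesMatrix, one_apply, kroneckerMap_apply]
    rw [this]
    exact (hJ.kronecker (posSemidef_smul_one_sub_ones t)).smul hc
  have hE : (of fun p q => e p * e q).PosSemidef :=
    posSemidef_of_gram (κ := Unit) (fun p _ => e p) (by simp [dotProduct])
  let X : Matrix (ColorIndex V t) (ColorIndex V t) ℝ := (of fun p q => e p * e q) +
    of fun p q => p.elim 0 fun i => q.elim 0 fun j => K i j
  have hsame : ∀ u v i, X (some (u, i)) (some (v, i)) = Z u v / t ^ 2 := fun u v i => by
    simp only [X, K, e, c, Matrix.add_apply, of_apply, Option.elim, if_true]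
    field_simp
    ring
  have hdiff : ∀ u v i j, i ≠ j → X (some (u, i)) (some (v, j)) = (t - Z u v) * c :=
    fun u v i j hij => by
      simp only [X, K, e, c, Matrix.add_apply, of_apply, Option.elim, if_neg hij]
      field_simp
      ring
  refine ⟨X, ⟨hE.add hK.option_extend, ?_⟩, ⟨⟨?_, ?_, ?_, ?_⟩, ?_⟩⟩
  · rintro (_ | ⟨u, i⟩) (_ | ⟨v, j⟩)
    · simp [X, e]
    · simp [X, e]
    · simp [X, e]
    · by_cases hij : i = j
      · subst hij
        rw [hsame]
        exact div_nonneg (hZ.2 u v) (sq_nonneg _)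
      · rw [hdiff u v i j hij]
        refine mul_nonneg (sub_nonneg.2 ?_) hc
        have := hZ.1.two_mul_abs_le u v
        rw [hd, hd] at this
        linarith [le_abs_self (Z u v)]
  · simp [X, e]
  · intro u
    simp [X, e, ht0]
  · intro u
    have : ∀ i j, X (some (u, i)) (some (u, j)) = if i = j then (t : ℝ)⁻¹ else 0 := fun i j => by
      split_ifs with hij
      · subst hij
        rw [hsame, hd]
        field_simp
      · rw [hdiff u u i j hij, hd]
        simp
    simp [this, ht0]
  · intro i u v huv
    rw [hsame, he u v huv, zero_div]
  · intro i j hij u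
    rw [hdiff u u i j hij, hd]
    simp

theorem mem_thetaPlusFeasible_of_weakColorConstraints
    {X : Matrix (ColorIndex V t) (ColorIndex V t) ℝ} (hX : X ∈ DNNCone (ColorIndex V t))
    (hc : WeakColorConstraints G t X) : (t : ℝ) ∈ thetaPlusFeasible Gᶜ := by
  obtain ⟨x, hx⟩ := hX.1.exists_gram
  have hY : (of fun u v => ∑ i, X (some (u, i)) (some (v, i))).PosSemidef := by
    have : (of fun u v => ∑ i, X (some (u, i)) (some (v, i))) =
        ∑ i, X.submatrix (fun u => some (u, i)) fun u => some (u, i) := by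
      ext u v
      simp [Matrix.sum_apply]
    rw [this]
    exact posSemidef_sum _ fun i _ => hX.1.submatrix _
  refine mem_thetaPlusFeasible_of_diag_le
    (X := (t : ℝ) • of fun u v => ∑ i, X (some (u, i)) (some (v, i)))
    ⟨hY.smul t.cast_nonneg, fun u v => ?_⟩ ?_ (fun u v huv => ?_) fun u => ?_
  · rw [Matrix.smul_apply, of_apply, smul_eq_mul]
    exact mul_nonneg t.cast_nonneg (Finset.sum_nonneg fun i _ => hX.2 _ _)
  · have hsum : ∀ u k, ∑ i, x (some (u, i)) k = x none k := fun u k => by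
      rw [← hc.sum_gram x hx u, Finset.sum_apply]
    have h1 : ∑ k, x none k * x none k = 1 := by
      rw [← hc.corner, hx]
      rfl
    -- For each Gram coordinate `k`, the rows of `A k = (x (some (u, i)) k)` all sum to `x none k`.
    -- So `A k * J * (A k)ᴴ` is `(x none k) ^ 2 • J`, and these squares sum to one.
    have key : (t : ℝ) • (of fun u v => ∑ i, X (some (u, i)) (some (v, i))) - onesMatrix V =
        ∑ k, (of fun u i => x (some (u, i)) k) *
          ((t : ℝ) • (1 : Matrix (Fin t) (Fin t) ℝ) - onesMatrix (Fin t)) *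
          (of fun u i => x (some (u, i)) k)ᴴ := by
      ext u v
      have h2 : ∀ k, ((of fun u i => x (some (u, i)) k) *
          ((t : ℝ) • (1 : Matrix (Fin t) (Fin t) ℝ) - onesMatrix (Fin t)) *
          (of fun u i => x (some (u, i)) k)ᴴ) u v =
          t * ∑ i, x (some (u, i)) k * x (some (v, i)) k - x none k * x none k := fun k => by
        rw [Matrix.mul_sub, Matrix.sub_mul, Matrix.sub_apply, Matrix.mul_smul, Matrix.mul_one, Matrix.smul_mul]
        simp only [Matrix.smul_apply, mul_apply, onesMatrix, of_apply, conjTranspose_apply, star_trivial,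
          mul_one, smul_eq_mul, hsum, ← mul_sum]
      rw [Matrix.sum_apply]
      simp only [h2, sum_sub_distrib, h1, ← mul_sum]
      rw [sum_comm]
      simp [onesMatrix, hx, dotProduct]
    rw [key]
    exact posSemidef_sum _ fun k _ =>
      (posSemidef_smul_one_sub_ones t).mul_mul_conjTranspose_same _
  · simp [hc.orth_edge _ u v huv]
  · have : ∑ i, X (some (u, i)) (some (u, i)) ≤ 1 := by
      rw [← hc.sum_block u]
      exact sum_le_sum fun i _ =>
        single_le_sum (f := fun j => X (some (u, i)) (some (u, j))) (fun j _ => hX.2 _ _)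
          (mem_univ i)
    simpa using mul_le_mul_of_nonneg_left this t.cast_nonneg

theorem one_le_of_mem_thetaPlusFeasible [Nonempty V] {H : SimpleGraph V} {s : ℝ}
    (hs : s ∈ thetaPlusFeasible H) : 1 ≤ s := by
  obtain ⟨Z, -, hJ, hd, -⟩ := hs
  have := hJ.diag_nonneg (i := Classical.arbitrary V)
  simpa [onesMatrix, hd] using this

theorem thetaPlusFeasible_nonempty (H : SimpleGraph V) : (thetaPlusFeasible H).Nonempty := by
  obtain ⟨X, hX, h⟩ := exists_thetaConstraints_of_colorable (Hᶜ.colorable_of_fintype)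
  exact ⟨_, compl_compl H ▸ mem_thetaPlusFeasible_of_thetaConstraints (cpCone_subset_dnnCone hX) h⟩

/-- The minimum defining `ϑ⁺` is attained. -/
theorem isLeast_thetaPlus [Nonempty V] (H : SimpleGraph V) :
    IsLeast (thetaPlusFeasible H) (thetaPlus H) := by
  obtain ⟨n, hn⟩ := thetaPlusFeasible_nonempty H
  let o : V := Classical.arbitrary V
  -- Capping the diagonal at a known feasible value `n` bounds all entries, so a minimizer exists by
  -- compactness.
  let S : Set (Matrix V V ℝ) := {Z | Z.PosSemidef} ∩ {Z | ∀ i j, 0 ≤ Z i j} ∩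
    {Z | (Z - onesMatrix V).PosSemidef} ∩ {Z | ∀ u, Z u u = Z o o} ∩
    {Z | ∀ u v, Hᶜ.Adj u v → Z u v = 0} ∩ {Z | Z o o ≤ n}
  have hclosed : IsClosed S := by
    refine ((((isClosed_setOf_posSemidef.inter ?_).inter ?_).inter ?_).inter ?_).inter ?_
    · simp only [Set.ofPred_forall]
      exact isClosed_iInter fun i => isClosed_iInter fun j =>
        isClosed_le (by fun_prop) (by fun_prop)
    · exact isClosed_setOf_posSemidef.preimage (continuous_id.sub continuous_const)
    · simp only [Set.ofPred_forall]
      exact isClosed_iInter fun i => isClosed_eq (by fun_prop) (by fun_prop)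
    · simp only [Set.ofPred_forall]
      exact isClosed_iInter fun i => isClosed_iInter fun j => isClosed_iInter fun _ =>
        isClosed_eq (by fun_prop) (by fun_prop)
    · exact isClosed_le (by fun_prop) (by fun_prop)
  have hsub : S ⊆ Set.pi Set.univ fun _ => Set.pi Set.univ fun _ => Set.Icc 0 n := by
    rintro Z ⟨⟨⟨⟨⟨hP, h0⟩, -⟩, hd⟩, -⟩, hle⟩ i - j -
    refine ⟨h0 i j, ?_⟩
    have h1 := hP.two_mul_abs_le i j
    rw [hd i, hd j] at h1
    have h2 : Z o o ≤ n := hle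
    linarith [le_abs_self (Z i j)]
  have hcomp : IsCompact S :=
    (isCompact_univ_pi fun _ => isCompact_univ_pi fun _ => isCompact_Icc).of_isClosed_subset
      hclosed hsub
  have hmem : ∀ s ≤ n, s ∈ thetaPlusFeasible H → ∃ Z ∈ S, Z o o = s := by
    rintro s hs ⟨Z, hZ, hJ, hd, he⟩
    exact ⟨Z, ⟨⟨⟨⟨⟨hZ.1, hZ.2⟩, hJ⟩, fun u => by rw [hd, hd]⟩, he⟩, (hd o).trans_le hs⟩, hd o⟩
  obtain ⟨Z₀, hZ₀, -⟩ := hmem n le_rfl hn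
  obtain ⟨Z, hZ, hmin⟩ := hcomp.exists_isMinOn ⟨Z₀, hZ₀⟩
    (f := fun Z : Matrix V V ℝ => Z o o) (by fun_prop)
  have hleast : IsLeast (thetaPlusFeasible H) (Z o o) := by
    refine ⟨?_, fun s hs => ?_⟩
    · obtain ⟨⟨⟨⟨⟨hP, h0⟩, hJ⟩, hd⟩, he⟩, -⟩ := hZ
      exact ⟨Z, ⟨hP, h0⟩, hJ, hd, he⟩
    · rcases le_total s n with h | h
      · obtain ⟨W, hW, rfl⟩ := hmem s h hs
        exact hmin hW
      · exact le_trans hZ.2 h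
  have : thetaPlus H = Z o o := hleast.csInf_eq
  rwa [this]

end Theta

/-! ### The equivalences and the least feasible `t` -/

theorem corollary4p9 {V : Type*} [Fintype V] (G : SimpleGraph V) :
    -- The three assertions are equivalent for the doubly nonnegative cone.
    (∀ t : ℕ, 1 ≤ t →
      ((∃ X ∈ DNNCone V, ThetaConstraints G t X) ↔
        ∃ X ∈ DNNCone (ColorIndex V t), ColorConstraints G t X) ∧
      ((∃ X ∈ DNNCone (ColorIndex V t), ColorConstraints G t X) ↔
        ∃ X ∈ DNNCone (ColorIndex V t), WeakColorConstraints G t X)) ∧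
    -- For the completely positive cone the last two are equivalent and imply the first.
    (∀ t : ℕ, 1 ≤ t →
      ((∃ X ∈ CPCone (ColorIndex V t), WeakColorConstraints G t X) ↔
        ∃ X ∈ CPCone (ColorIndex V t), ColorConstraints G t X) ∧
      ((∃ X ∈ CPCone (ColorIndex V t), ColorConstraints G t X) →
        ∃ X ∈ CPCone V, ThetaConstraints G t X)) ∧
    -- For a nonempty graph the minimum defining `ϑ⁺` of the complement is attained, and its
    -- ceiling is the least feasible `t` for the doubly nonnegative cone.
    (Nonempty V →
      IsLeast (thetaPlusFeasible Gᶜ) (thetaPlus Gᶜ) ∧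
      ∃ s : ℕ, (s : ℤ) = ⌈thetaPlus Gᶜ⌉ ∧
        IsLeast {t : ℕ | ∃ X ∈ DNNCone (ColorIndex V t), ColorConstraints G t X} s ∧
        IsLeast {t : ℕ | ∃ X ∈ DNNCone (ColorIndex V t), WeakColorConstraints G t X} s) ∧
    -- The chromatic number is the least feasible `t` for the completely positive cone.
    (∃ s : ℕ, (s : ℕ∞) = G.chromaticNumber ∧
      IsLeast {t : ℕ | ∃ X ∈ CPCone (ColorIndex V t), ColorConstraints G t X} s ∧
      IsLeast {t : ℕ | ∃ X ∈ CPCone (ColorIndex V t), WeakColorConstraints G t X} s) := by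
  have hiii : ∀ {t : ℕ}, (∃ X ∈ DNNCone (ColorIndex V t), ColorConstraints G t X) →
      ∃ X ∈ DNNCone (ColorIndex V t), WeakColorConstraints G t X :=
    fun ⟨X, hX, h⟩ => ⟨X, hX, h.toWeakColorConstraints⟩
  have hfeas : ∀ {t : ℕ}, (∃ X ∈ DNNCone (ColorIndex V t), WeakColorConstraints G t X) →
      (t : ℝ) ∈ thetaPlusFeasible Gᶜ :=
    fun ⟨X, hX, h⟩ => mem_thetaPlusFeasible_of_weakColorConstraints hX h
  have hcol : ∀ {t : ℕ}, (∃ X ∈ CPCone (ColorIndex V t), WeakColorConstraints G t X) ↔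
      G.Colorable t := fun {t} =>
    ⟨fun ⟨X, hX, h⟩ => colorable_of_mem_cpCone hX h, fun h =>
      let ⟨X, hX, hc⟩ := exists_colorConstraints_of_colorable h
      ⟨X, hX, hc.toWeakColorConstraints⟩⟩
  have hcol' : ∀ {t : ℕ}, (∃ X ∈ CPCone (ColorIndex V t), ColorConstraints G t X) ↔
      G.Colorable t := fun {t} =>
    ⟨fun ⟨X, hX, h⟩ => colorable_of_mem_cpCone hX h.toWeakColorConstraints,
      exists_colorConstraints_of_colorable⟩
  refine ⟨fun t ht => ⟨⟨?_, fun h => ?_⟩, hiii, fun h => ?_⟩, fun t _ => ⟨?_, fun h => ?_⟩,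
    fun hV => ⟨isLeast_thetaPlus _, ?_⟩, ?_⟩
  · rintro ⟨X, hX, h⟩
    exact exists_colorConstraints_of_mem_thetaPlusFeasible ht
      (mem_thetaPlusFeasible_of_thetaConstraints hX h)
  · exact exists_thetaConstraints_of_mem (hfeas (hiii h)) (Int.ceil_natCast t)
  · exact exists_colorConstraints_of_mem_thetaPlusFeasible ht (hfeas h)
  · rw [hcol, hcol']
  · exact exists_thetaConstraints_of_colorable (hcol'.1 h)
  · have hmin := isLeast_thetaPlus Gᶜ
    have h1 := one_le_of_mem_thetaPlusFeasible hmin.1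
    -- Positivity matters because the lift from `Z` to `X` needs `t ≥ 1`.
    have hpos : 0 < ⌈thetaPlus Gᶜ⌉ := Int.ceil_pos.2 (by linarith)
    obtain ⟨s, hs⟩ := Int.eq_ofNat_of_zero_le hpos.le
    have hfs : ∃ X ∈ DNNCone (ColorIndex V s), ColorConstraints G s X := by
      obtain ⟨X, hX, h⟩ := exists_thetaConstraints_of_mem hmin.1 hs
      exact exists_colorConstraints_of_mem_thetaPlusFeasible (by omega)
        (mem_thetaPlusFeasible_of_thetaConstraints hX h)
    have hlow : ∀ t : ℕ, (∃ X ∈ DNNCone (ColorIndex V t), WeakColorConstraints G t X) →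
        s ≤ t := fun t h => by
      have := Int.ceil_mono (hmin.2 (hfeas h))
      rw [hs, Int.ceil_natCast] at this
      exact_mod_cast this
    exact ⟨s, hs.symm, ⟨hfs, fun t h => hlow t (hiii h)⟩, ⟨hiii hfs, hlow⟩⟩
  · have hex := G.colorable_chromaticNumber_of_fintype
    have htop : G.chromaticNumber ≠ ⊤ :=
      SimpleGraph.chromaticNumber_ne_top_iff_exists.2 ⟨_, hex⟩
    have hle : ∀ t : ℕ, G.Colorable t → ENat.toNat G.chromaticNumber ≤ t := fun t h =>
      ENat.toNat_le_of_le_natCast h.chromaticNumber_le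
    refine ⟨ENat.toNat G.chromaticNumber, ENat.natCast_toNat htop, ?_, ?_⟩
    · exact ⟨hcol'.2 hex, fun t h => hle t (hcol'.1 h)⟩
    · exact ⟨hcol.2 hex, fun t h => hle t (hcol.1 h)⟩
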